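/- **Theorem.** Let $\nu>0$, let $\Gamma\subset\mathbb C$ be a full-rank lattice with cell area $S(\Gamma)$, and let $\chi:\Gamma\to\{\lambda\in\mathbb C:|\lambda|=1\}$ be a pseudo-character, that is, $$\chi(\gamma+\gamma')=\chi(\gamma)\chi(\gamma')e^{\frac{\nu}{2}(\gamma\overline{\gamma'}-\overline{\gamma}\gamma')}\qquad(\gamma,\gamma'\in\Gamma).$$ Let $\Lambda\subset\mathbb C$ be a fundamental cell of $\Gamma$, i.e. a measurable set that contains exactly one point of each class modulo $\Gamma$ (for instance a half-open period parallelogram). Let $\mathcal O=\mathcal O^\nu_{\Gamma,\chi}(\mathbb C)$ be the theta Bargmann–Fock space, i.e. the space of entire functions $f$ with $f(z+\gamma)=\chi(\gamma)e^{\nu(z+\gamma/2)\overline\gamma}f(z)$ for all $z\in\mathbb C$, $\gamma\in\Gamma$, and $\int_\Lambda|f(z)|^2e^{-\nu|z|^2}\,dx\,dy<\infty$. For $z,w\in\mathbb C$ put $$K(z,w)=\frac{\nu}{\pi}\sum_{\gamma\in\Gamma}\chi(\gamma)e^{-\frac{\nu}{2}|\gamma|^2+\nu(z\overline\gamma-\overline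 w\gamma+z\overline w)},\qquad \varphi_w=K(\cdot,w),\qquad Z_w=\{z\in\Lambda:\varphi_w(z)=0\}.$$ The series converges absolutely for all $z,w\in\mathbb C$. Let $\mathcal Z(K)\subset\mathbb C\times\mathbb C$ be the set of zeros of $K$. Then: 1. $\mathcal Z(K)$ is symmetric: $(z,w)\in\mathcal Z(K)$ if and only if $(w,z)\in\mathcal Z(K)$. 2. The zeros with at least one coordinate in $\Lambda$ are given by $$\mathcal Z(K)\cap\big((\Lambda\times\mathbb C)\cup(\mathbb C\times\Lambda)\big)=\bigcup_{w\in\Lambda}\big((Z_w+\Gamma)\times\{w\}\big)\ \cup\ \bigcup_{w\in\Lambda}\big(\{w\}\times(Z_w+\Gamma)\big),$$ and the whole zero set is given by $$\mathcal Z(K)=\bigcup_{w\in\Lambda}\big((Z_w+\Gamma)\times(\{w\}+\Gamma)\big)\ \cup\ \bigcup_{w\in\Lambda}\big((\{w\}+\Gamma)\times(Z_w+\Gamma)\big).$$ 3. The set of common zeros in $\Lambda$ of all $f\in\mathcal O$ equals $\Xi=\{\widetilde w\in\Lambda:\varphi_{\widetilde w}\equiv0\text{ on }\Lambda\}$. 4.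 $\Xi$ is finite, $\mathcal O$ is finite-dimensional, and $\#\Xi\le\dim\mathcal O=\frac{\nu}{\pi}S(\Gamma)$. -/

import Mathlib

open scoped Pointwise ComplexConjugate

noncomputable section

/-- A unimodular map `χ` on the lattice `Γ` with
`χ (γ + γ') = χ γ * χ γ' * exp ((ν / 2) * (γ * conj γ' - conj γ * γ'))`. -/
def IsPseudoCharacter (ν : ℝ) (Γ : Submodule ℤ ℂ) (χ : Γ → Circle) : Prop :=
  ∀ γ γ' : Γ, (χ (γ + γ') : ℂ) =
    (χ γ : ℂ) * (χ γ' : ℂ) *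
      Complex.exp ((ν : ℂ) / 2 * ((γ : ℂ) * conj (γ' : ℂ) - conj (γ : ℂ) * (γ' : ℂ)))

/-- A fundamental cell: a measurable set that meets every class modulo `Γ` exactly once.
Every half-open period parallelogram, wherever it is placed, is an example. -/
structure IsFundamentalCell (Γ : Submodule ℤ ℂ) (Λ : Set ℂ) : Prop where
  measurableSet : MeasurableSet Λ
  existsUnique_add_mem : ∀ z : ℂ, ∃! γ : Γ, z + (γ : ℂ) ∈ Λ

/-- The theta Bargmann-Fock space: entire functions `f` with
`f (z + γ) = χ γ * exp (ν * (z + γ / 2) * conj γ) * f z` for all `γ ∈ Γ`, and with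
`|f z| ^ 2 * exp (-ν * |z| ^ 2)` integrable over the cell `Λ`. -/
def thetaSpace (ν : ℝ) (Γ : Submodule ℤ ℂ) (χ : Γ → Circle) (Λ : Set ℂ) :
    Submodule ℂ (ℂ → ℂ) where
  carrier := {f | Differentiable ℂ f ∧
    (∀ (z : ℂ) (γ : Γ), f (z + γ) =
      (χ γ : ℂ) * Complex.exp ((ν : ℂ) * (z + (γ : ℂ) / 2) * conj (γ : ℂ)) * f z) ∧
    MeasureTheory.MemLp (fun z : ℂ => ((Real.exp (-(ν / 2) * ‖z‖ ^ 2) : ℝ) : ℂ) * f z) 2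
      (MeasureTheory.volume.restrict Λ)}
  zero_mem' := by
    refine ⟨differentiable_const 0, fun z γ => by simp, ?_⟩
    simp
  add_mem' := by
    rintro f g ⟨hf, hf', hf''⟩ ⟨hg, hg', hg''⟩
    refine ⟨hf.add hg, fun z γ => ?_, ?_⟩
    · simp only [Pi.add_apply, hf' z γ, hg' z γ]
      ring
    · have h := hf''.add hg''
      convert h using 1
      funext z
      simp only [Pi.add_apply]
      ring
  smul_mem' := by
    rintro c f ⟨hf, hf', hf''⟩
    refine ⟨hf.const_smul c, fun z γ => ?_, ?_⟩
    · simp only [Pi.smul_apply, hf' z γ, smul_eq_mul]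
      ring
    · have h := hf''.const_smul c
      convert h using 1
      funext z
      simp only [Pi.smul_apply, smul_eq_mul]
      ring

/-- The term of index `γ` of the series for the kernel. -/
def thetaKernelTerm (ν : ℝ) (Γ : Submodule ℤ ℂ) (χ : Γ → Circle) (z w : ℂ) (γ : Γ) : ℂ :=
  (χ γ : ℂ) * Complex.exp (-((ν : ℂ) / 2) * ((‖(γ : ℂ)‖ ^ 2 : ℝ) : ℂ) +
    (ν : ℂ) * (z * conj (γ : ℂ) - conj w * (γ : ℂ) + z * conj w))

/-- The kernel
`K (z, w) = (ν / π) ∑ χ γ * exp (-(ν / 2) |γ| ^ 2 + ν (z conj γ - conj w γ + z conj w))`. -/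
def thetaKernel (ν : ℝ) (Γ : Submodule ℤ ℂ) (χ : Γ → Circle) (z w : ℂ) : ℂ :=
  ((ν : ℂ) / (Real.pi : ℂ)) * ∑' γ : Γ, thetaKernelTerm ν Γ χ z w γ

/-- The set of zeros of the kernel in `ℂ × ℂ`. -/
def kernelZeros (ν : ℝ) (Γ : Submodule ℤ ℂ) (χ : Γ → Circle) : Set (ℂ × ℂ) :=
  {p | thetaKernel ν Γ χ p.1 p.2 = 0}

/-- The set of zeros of `f` that lie in `Λ`. -/
def zerosIn (Λ : Set ℂ) (f : ℂ → ℂ) : Set ℂ :=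
  {z | z ∈ Λ ∧ f z = 0}

/-- The function `φ_w = K (·, w)`. -/
def kernelSection (ν : ℝ) (Γ : Submodule ℤ ℂ) (χ : Γ → Circle) (w : ℂ) : ℂ → ℂ :=
  fun z => thetaKernel ν Γ χ z w

/-- The set `Ξ` of the points `w` of the cell `Λ` such that `φ_w` vanishes identically
on `Λ`. -/
def xiSet (ν : ℝ) (Γ : Submodule ℤ ℂ) (χ : Γ → Circle) (Λ : Set ℂ) : Set ℂ :=
  {w | w ∈ Λ ∧ ∀ z ∈ Λ, kernelSection ν Γ χ w z = 0}

end

/-! ### Quasi-periodicity and Hermitian symmetry of the kernel; the zero-set formulas. -/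

section PseudoCharacter

variable {ν : ℝ} {Γ : Submodule ℤ ℂ} {χ : Γ → Circle}

/-! The kernel is Hermitian and quasi-periodic in each variable, so its zero set is symmetric and `Γ
× Γ`-invariant; the zero-set formulas use nothing more. The rest depends on `K` being the
reproducing kernel of the theta space: unfolding the integral over the cell gives the Bargmann
integral over `ℂ`, which the Gaussian mean value property evaluates
(`IsThetaFunction.integral_mul_thetaKernel`). Hence all functions vanish at `w` exactly when `φ_w`
vanishes on the cell.

The dimension is a trace. For an orthonormal basis `f_i` of a finite-dimensional subspace, Bessel
gives `∑ |f_i w|² ≤ K w w`, with equality for the whole space. In the weighted integral of `K w w`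
over the cell only `γ = 0` survives, since the other terms are nontrivial characters of the torus;
this leaves `ν / π` times the area.

For `#Ξ`, fix `f ≠ 0` with `n` incongruent zeros. Multiplication by `f` embeds the space of level
`k` (data `kν`, `χ ^ k`) into the functions of level `k + 1` vanishing there. For large `k` these
vanishing conditions are independent, because the weighted kernel matrix at the points tends to the
identity. Comparing dimensions bounds `n` by `ν / π` times the area (`card_zeros_le`), and every
point of `Ξ` is a zero of `f`. -/

theorem IsPseudoCharacter.exp_symplectic_eq_one (hχ : IsPseudoCharacter ν Γ χ) (γ δ : Γ) :
    Complex.exp ((ν : ℂ) * ((γ : ℂ) * conj (δ : ℂ) - conj (γ : ℂ) * (δ : ℂ))) = 1 := by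
  -- Commutativity of `Γ` forces the two cocycle factors, whose exponents are opposite, to agree;
  -- their quotient is the exponential in question.
  have h1 := hχ γ δ
  have h2 := hχ δ γ
  rw [add_comm δ γ, h1] at h2
  have h3 : (χ γ : ℂ) * (χ δ : ℂ) ≠ 0 := mul_ne_zero (Circle.coe_ne_zero _) (Circle.coe_ne_zero _)
  have h4 : Complex.exp ((ν : ℂ) / 2 * ((γ : ℂ) * conj (δ : ℂ) - conj (γ : ℂ) * (δ : ℂ))) =
      Complex.exp ((ν : ℂ) / 2 * ((δ : ℂ) * conj (γ : ℂ) - conj (δ : ℂ) * (γ : ℂ))) := by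
    apply mul_left_cancel₀ h3
    rw [h2]; ring
  have h5 : (ν : ℂ) * ((γ : ℂ) * conj (δ : ℂ) - conj (γ : ℂ) * (δ : ℂ)) =
      (ν : ℂ) / 2 * ((γ : ℂ) * conj (δ : ℂ) - conj (γ : ℂ) * (δ : ℂ)) -
      (ν : ℂ) / 2 * ((δ : ℂ) * conj (γ : ℂ) - conj (δ : ℂ) * (γ : ℂ)) := by ring
  rw [h5, Complex.exp_sub, h4, div_self (Complex.exp_ne_zero _)]

theorem IsPseudoCharacter.map_zero (hχ : IsPseudoCharacter ν Γ χ) : (χ 0 : ℂ) = 1 := by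
  have h := hχ 0 0
  have h0 : (χ 0 : ℂ) ≠ 0 := Circle.coe_ne_zero _
  simp at h
  exact h

theorem IsPseudoCharacter.conj_map_neg (hχ : IsPseudoCharacter ν Γ χ) (γ : Γ) :
    conj (χ (-γ) : ℂ) = χ γ := by
  have h := hχ γ (-γ)
  rw [add_neg_cancel, hχ.map_zero] at h
  have h1 : (χ γ : ℂ) * (χ (-γ) : ℂ) = 1 := by
    rw [h]
    simp [mul_comm]
  have h2 : conj (χ (-γ) : ℂ) * (χ (-γ) : ℂ) = 1 := by
    rw [mul_comm, Complex.mul_conj]; simp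
  exact mul_right_cancel₀ (Circle.coe_ne_zero (χ (-γ))) (h2.trans h1.symm)

/-- Tensor powers satisfy the same hypotheses, so every result for `ν` also holds at level `k ≥ 1`.
-/
theorem IsPseudoCharacter.pow (hχ : IsPseudoCharacter ν Γ χ) (k : ℕ) :
    IsPseudoCharacter (k * ν) Γ (χ ^ k) := by
  intro γ δ
  simp only [Pi.pow_apply, Circle.coe_pow, hχ γ δ, mul_pow, ← Complex.exp_nat_mul]
  congr 2
  push_cast
  ring

/-- The terms of the kernel series are governed by the shifted Gaussian on the lattice. -/
theorem norm_thetaKernelTerm (ν : ℝ) (χ : Γ → Circle) (z w : ℂ) (γ : Γ) :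
    ‖thetaKernelTerm ν Γ χ z w γ‖ =
      Real.exp (ν / 2 * (‖z‖ ^ 2 + ‖w‖ ^ 2)) *
        Real.exp (-(ν / 2) * ‖(γ : ℂ) - (z - w)‖ ^ 2) := by
  rw [thetaKernelTerm, norm_mul, Circle.norm_coe, one_mul, Complex.norm_exp, ← Real.exp_add]
  congr 1
  simp only [Complex.sq_norm, Complex.normSq_apply, Complex.add_re, Complex.mul_re, Complex.sub_re,
    Complex.sub_im, Complex.add_im, Complex.mul_im, Complex.conj_re, Complex.conj_im,
    Complex.ofReal_re, Complex.ofReal_im, Complex.neg_re, Complex.neg_im, Complex.div_ofNat_re,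
    Complex.div_ofNat_im]
  ring

/-- The two sides differ by a symplectic exponential of a pair of lattice vectors, which is `1`. -/
theorem thetaKernelTerm_add (hχ : IsPseudoCharacter ν Γ χ) (z w : ℂ) (γ δ : Γ) :
    thetaKernelTerm ν Γ χ (z + γ) w (γ + δ) =
      (χ γ : ℂ) * Complex.exp ((ν : ℂ) * (z + (γ : ℂ) / 2) * conj (γ : ℂ)) *
        thetaKernelTerm ν Γ χ z w δ := by
  have h := hχ.exp_symplectic_eq_one γ δ
  simp only [thetaKernelTerm, hχ γ δ]
  rw [← mul_one ((χ γ : ℂ) * Complex.exp ((ν : ℂ) * (z + (γ : ℂ) / 2) * conj (γ : ℂ)) * _), ← h]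
  have e : ∀ a b c d e f : ℂ, c + d = e + a + b → χ γ * χ δ * Complex.exp c * Complex.exp d =
      χ γ * Complex.exp e * (χ δ * Complex.exp a) * Complex.exp b := by
    intro a b c d e f h
    have : Complex.exp c * Complex.exp d = Complex.exp e * Complex.exp a * Complex.exp b := by
      rw [← Complex.exp_add, h, Complex.exp_add, Complex.exp_add]
    linear_combination (χ γ * χ δ : ℂ) * this
  apply e
  -- Any value would do: this number does not enter the identity.
  · exact 0
  simp only [Complex.ofReal_pow, ← Complex.mul_conj', Submodule.coe_add, map_add]
  ring

theorem thetaKernel_add (hχ : IsPseudoCharacter ν Γ χ) (z w : ℂ) (γ : Γ) :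
    thetaKernel ν Γ χ (z + γ) w =
      (χ γ : ℂ) * Complex.exp ((ν : ℂ) * (z + (γ : ℂ) / 2) * conj (γ : ℂ)) *
        thetaKernel ν Γ χ z w := by
  rw [thetaKernel, ← (Equiv.addLeft γ).tsum_eq]
  simp only [Equiv.coe_addLeft, thetaKernelTerm_add hχ, tsum_mul_left, thetaKernel]
  ring

/-- Conjugation exchanges the terms of index `γ` and `-γ`, as `χ (-γ)` is the conjugate of `χ γ`. -/
theorem conj_thetaKernel (hχ : IsPseudoCharacter ν Γ χ) (z w : ℂ) :
    conj (thetaKernel ν Γ χ z w) = thetaKernel ν Γ χ w z := by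
  rw [thetaKernel, ← (Equiv.neg Γ).tsum_eq, map_mul, Complex.conj_tsum, thetaKernel]
  congr 1
  · simp
  refine tsum_congr fun γ => ?_
  simp only [thetaKernelTerm, Equiv.neg_apply, map_mul, hχ.conj_map_neg, ← Complex.exp_conj]
  congr 2
  simp only [map_add, map_sub, map_mul, map_neg, map_div₀, Complex.conj_ofReal, Complex.conj_conj,
    map_ofNat, Submodule.coe_neg, norm_neg]
  ring

theorem thetaKernel_eq_zero_comm (hχ : IsPseudoCharacter ν Γ χ) {z w : ℂ} :
    thetaKernel ν Γ χ z w = 0 ↔ thetaKernel ν Γ χ w z = 0 := by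
  rw [← conj_thetaKernel hχ w z, map_eq_zero]

theorem thetaKernel_add_eq_zero_iff (hχ : IsPseudoCharacter ν Γ χ) (z w : ℂ) (γ : Γ) :
    thetaKernel ν Γ χ (z + γ) w = 0 ↔ thetaKernel ν Γ χ z w = 0 := by
  simp [thetaKernel_add hχ]

theorem thetaKernel_add_right_eq_zero_iff (hχ : IsPseudoCharacter ν Γ χ) (z w : ℂ) (γ : Γ) :
    thetaKernel ν Γ χ z (w + γ) = 0 ↔ thetaKernel ν Γ χ z w = 0 := by
  rw [thetaKernel_eq_zero_comm hχ, thetaKernel_add_eq_zero_iff hχ, thetaKernel_eq_zero_comm hχ]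

/-- Zeros of a section are `Γ`-invariant and every point has a translate in the cell. Both zero-set
formulas thereby reduce to the vanishing of `K`. -/
theorem mem_zerosIn_kernelSection_add_iff (hχ : IsPseudoCharacter ν Γ χ) {Λ : Set ℂ}
    (hΛ : IsFundamentalCell Γ Λ) (z w : ℂ) :
    z ∈ zerosIn Λ (kernelSection ν Γ χ w) + (Γ : Set ℂ) ↔ thetaKernel ν Γ χ z w = 0 := by
  constructor
  · rintro ⟨a, ⟨-, ha⟩, g, hg, rfl⟩
    exact (thetaKernel_add_eq_zero_iff hχ a w ⟨g, hg⟩).2 ha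
  · intro h
    obtain ⟨γ, hγ, -⟩ := hΛ.existsUnique_add_mem z
    exact ⟨z + γ, ⟨hγ, (thetaKernel_add_eq_zero_iff hχ z w γ).2 h⟩, -γ, by simp, by simp⟩

theorem kernelZeros_inter_eq (hχ : IsPseudoCharacter ν Γ χ) {Λ : Set ℂ}
    (hΛ : IsFundamentalCell Γ Λ) :
    kernelZeros ν Γ χ ∩ {p | p.1 ∈ Λ ∨ p.2 ∈ Λ} =
      (⋃ w ∈ Λ, (zerosIn Λ (kernelSection ν Γ χ w) + (Γ : Set ℂ)) ×ˢ ({w} : Set ℂ)) ∪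
      (⋃ w ∈ Λ, ({w} : Set ℂ) ×ˢ (zerosIn Λ (kernelSection ν Γ χ w) + (Γ : Set ℂ))) := by
  ext ⟨z, w⟩
  simp only [Set.mem_inter_iff, Set.mem_ofPred_eq, Set.mem_union, Set.mem_iUnion, Set.mem_prod,
    Set.mem_singleton_iff, mem_zerosIn_kernelSection_add_iff hχ hΛ, kernelZeros, exists_prop]
  constructor
  · rintro ⟨h, hz | hw⟩
    · exact Or.inr ⟨z, hz, rfl, (thetaKernel_eq_zero_comm hχ).1 h⟩
    · exact Or.inl ⟨w, hw, h, rfl⟩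
  · rintro (⟨w, hw, h, rfl⟩ | ⟨z, hz, rfl, h⟩)
    · exact ⟨h, Or.inr hw⟩
    · exact ⟨(thetaKernel_eq_zero_comm hχ).1 h, Or.inl hz⟩

theorem kernelZeros_eq (hχ : IsPseudoCharacter ν Γ χ) {Λ : Set ℂ}
    (hΛ : IsFundamentalCell Γ Λ) :
    kernelZeros ν Γ χ =
      (⋃ w ∈ Λ, (zerosIn Λ (kernelSection ν Γ χ w) + (Γ : Set ℂ)) ×ˢ
        (({w} : Set ℂ) + (Γ : Set ℂ))) ∪
      (⋃ w ∈ Λ, (({w} : Set ℂ) + (Γ : Set ℂ)) ×ˢ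
        (zerosIn Λ (kernelSection ν Γ χ w) + (Γ : Set ℂ))) := by
  ext ⟨z, w⟩
  simp only [Set.mem_ofPred_eq, Set.mem_union, Set.mem_iUnion, Set.mem_prod,
    mem_zerosIn_kernelSection_add_iff hχ hΛ, kernelZeros, exists_prop]
  constructor
  · intro h
    obtain ⟨γ, hγ, -⟩ := hΛ.existsUnique_add_mem w
    exact Or.inl ⟨w + γ, hγ, (thetaKernel_add_right_eq_zero_iff hχ z w γ).2 h,
      w + γ, rfl, -γ, by simp, by simp⟩
  · rintro (⟨a, -, h, _, rfl, g, hg, rfl⟩ | ⟨a, -, ⟨_, rfl, g, hg, rfl⟩, h⟩)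
    · exact (thetaKernel_add_right_eq_zero_iff hχ z _ ⟨g, hg⟩).2 h
    · rw [thetaKernel_eq_zero_comm hχ]
      exact (thetaKernel_add_right_eq_zero_iff hχ w _ ⟨g, hg⟩).2 h

end PseudoCharacter

/-! ### Absolute convergence and holomorphy of the kernel. -/

section Summability

variable {ν : ℝ} {Γ : Submodule ℤ ℂ} [DiscreteTopology Γ] [IsZLattice ℝ Γ]
  {χ : Γ → Circle}

theorem Real.exp_neg_le_two_div_sq {x : ℝ} (hx : 0 < x) : Real.exp (-x) ≤ 2 / x ^ 2 := by
  have h : x ^ 2 / 2 ≤ Real.exp x := by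
    have := Real.quadratic_le_exp_of_nonneg hx.le
    linarith
  rw [Real.exp_neg, ← inv_div]
  exact inv_anti₀ (by positivity) h

/-- The Gaussian is dominated by `‖γ - a‖⁻⁴`, summable because the exponent exceeds the rank `2`. -/
theorem summable_exp_neg_mul_norm_sub_sq (Γ : Submodule ℤ ℂ) [DiscreteTopology Γ]
    [IsZLattice ℝ Γ] {c : ℝ} (hc : 0 < c) (a : ℂ) :
    Summable fun γ : Γ => Real.exp (-c * ‖(γ : ℂ) - a‖ ^ 2) := by
  have hrank : Module.finrank ℤ Γ < 4 := by
    rw [ZLattice.rank ℝ Γ, Complex.finrank_real_complex]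
    norm_num
  have hs := (ZLattice.summable_norm_sub_inv_pow (L := Γ) 4 hrank a).mul_left (2 / c ^ 2)
  refine .of_norm_bounded_eventually hs ?_
  -- At `γ = a` the comparison term is `0` by the convention on inverses, so this index is set
  -- aside.
  have hfin : {γ : Γ | (γ : ℂ) = a}.Finite :=
    Set.Subsingleton.finite fun x hx y hy => Subtype.ext (hx.trans hy.symm)
  filter_upwards [hfin.compl_mem_cofinite] with γ hγ
  have hpos : 0 < ‖(γ : ℂ) - a‖ := norm_pos_iff.2 (sub_ne_zero.2 hγ)
  rw [Real.norm_of_nonneg (Real.exp_pos _).le, neg_mul]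
  refine (Real.exp_neg_le_two_div_sq (by positivity)).trans (le_of_eq ?_)
  field_simp

theorem summable_norm_thetaKernelTerm (hν : 0 < ν) (z w : ℂ) :
    Summable fun γ : Γ => ‖thetaKernelTerm ν Γ χ z w γ‖ := by
  simp only [norm_thetaKernelTerm]
  exact (summable_exp_neg_mul_norm_sub_sq Γ (half_pos hν) _).mul_left _

theorem differentiable_kernelSection (hν : 0 < ν) (w : ℂ) :
    Differentiable ℂ (kernelSection ν Γ χ w) := by
  refine (Differentiable.const_mul ?_ _ :
    Differentiable ℂ fun z => (ν : ℂ) / Real.pi * ∑' γ : Γ, thetaKernelTerm ν Γ χ z w γ)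
  intro z₀
  set R : ℝ := ‖z₀‖ + 1 with hR
  have hz₀ : z₀ ∈ Metric.ball (0 : ℂ) R := by simp [hR]
  -- A bound uniform on `‖z‖ < R`: moving the centre from `z - w` to `-w` halves the Gaussian rate
  -- and costs the factor `exp (ν / 2 * R ^ 2)`.
  have hsum : Summable fun γ : Γ => Real.exp (ν / 2 * (R ^ 2 + ‖w‖ ^ 2)) *
      (Real.exp (ν / 2 * R ^ 2) * Real.exp (-(ν / 4) * ‖(γ : ℂ) - (-w)‖ ^ 2)) :=
    ((summable_exp_neg_mul_norm_sub_sq Γ (by positivity) _).mul_left _).mul_left _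
  refine (Complex.differentiableOn_tsum_of_summable_norm hsum (fun γ => ?_) Metric.isOpen_ball
    (fun γ z hz => ?_)).differentiableAt (Metric.isOpen_ball.mem_nhds hz₀)
  · unfold thetaKernelTerm
    fun_prop
  · rw [mem_ball_zero_iff] at hz
    rw [norm_thetaKernelTerm, ← Real.exp_add (ν / 2 * R ^ 2)]
    have h0 := norm_nonneg z
    have hz2 : ‖z‖ ^ 2 ≤ R ^ 2 := by gcongr
    have h1 : ‖(γ : ℂ) - (-w)‖ ≤ ‖(γ : ℂ) - (z - w)‖ + ‖z‖ := by
      have := norm_add_le ((γ : ℂ) - (z - w)) z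
      rwa [show (γ : ℂ) - (z - w) + z = γ - (-w) by ring] at this
    have h2 : ‖(γ : ℂ) - (-w)‖ ^ 2 ≤ 2 * ‖(γ : ℂ) - (z - w)‖ ^ 2 + 2 * R ^ 2 := by
      have h3 := norm_nonneg ((γ : ℂ) - (-w))
      nlinarith [sq_nonneg (‖(γ : ℂ) - (z - w)‖ - ‖z‖)]
    gcongr
    nlinarith

end Summability

/-! ### Mean value property for Gaussian measure. -/

section GaussianMeanValue

open MeasureTheory Set

theorem Differentiable.setIntegral_polar_angle {g : ℂ → ℂ} (hg : Differentiable ℂ g) (r : ℝ) :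
    ∫ θ in Ioo (-Real.pi) Real.pi, g (Complex.polarCoord.symm (r, θ)) = 2 * Real.pi * g 0 := by
  have h := DiffContOnCl.circleAverage (f := g) (c := 0) (R := r) hg.diffContOnCl
  have hper : Function.Periodic (fun θ => g (circleMap 0 r θ)) (2 * Real.pi) := fun θ => by
    simp only [periodic_circleMap 0 r θ]
  have h2 := hper.intervalIntegral_add_eq (-Real.pi) 0
  rw [zero_add, show -Real.pi + 2 * Real.pi = Real.pi by ring] at h2
  rw [Real.circleAverage_def, ← h2, intervalIntegral.integral_of_le (by linarith [Real.pi_pos]),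
    integral_Ioc_eq_integral_Ioo] at h
  have h3 : ∀ θ : ℝ, Complex.polarCoord.symm (r, θ) = circleMap 0 r θ := fun θ => by
    rw [Complex.polarCoord_symm_apply, circleMap, zero_add, Complex.exp_mul_I]
    simp
  simp only [h3]
  rw [← h, Complex.real_smul]
  have := Real.pi_ne_zero
  push_cast
  field_simp

/-- In polar coordinates each circle contributes `2π g(0)`, and the radial integral is `1 / (2c)`.
-/
theorem Differentiable.integral_mul_gaussian {g : ℂ → ℂ} (hg : Differentiable ℂ g) {c : ℝ}
    (hc : 0 < c) (hint : Integrable fun z : ℂ => g z * (Real.exp (-c * ‖z‖ ^ 2) : ℝ)) :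
    ∫ z : ℂ, g z * (Real.exp (-c * ‖z‖ ^ 2) : ℝ) = Real.pi / c * g 0 := by
  set F : ℂ → ℂ := fun z => g z * (Real.exp (-c * ‖z‖ ^ 2) : ℝ) with hF
  have hFc : Continuous F := by
    have := hg.continuous
    fun_prop
  have hcont : Continuous fun p : ℝ × ℝ => p.1 • F (Complex.polarCoord.symm p) := by
    simp only [Complex.polarCoord_symm_apply]
    fun_prop
  have hI : IntegrableOn (fun p : ℝ × ℝ => p.1 • F (Complex.polarCoord.symm p))
      (Ioi 0 ×ˢ Ioo (-Real.pi) Real.pi) := by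
    refine ⟨hcont.aestronglyMeasurable, ?_⟩
    have h := Complex.lintegral_comp_polarCoord_symm fun z => ‖F z‖ₑ
    rw [polarCoord_target] at h
    have h' := hint.2
    rw [HasFiniteIntegral, ← h] at h'
    rw [HasFiniteIntegral]
    refine lt_of_le_of_lt (le_of_eq ?_) h'
    refine setLIntegral_congr_fun (measurableSet_Ioi.prod measurableSet_Ioo) fun p hp => ?_
    simp only [enorm_smul, smul_eq_mul]
    rw [Real.enorm_eq_ofReal (le_of_lt hp.1)]
  rw [← Complex.integral_comp_polarCoord_symm, polarCoord_target, Measure.volume_eq_prod,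
    setIntegral_prod _ hI]
  have hin : ∀ r : ℝ, ∫ θ in Ioo (-Real.pi) Real.pi, r • F (Complex.polarCoord.symm (r, θ)) =
      (r : ℂ) * Complex.exp (-(c : ℂ) * (r : ℂ) ^ 2) * (2 * Real.pi * g 0) := by
    intro r
    rw [← hg.setIntegral_polar_angle r, ← integral_const_mul]
    refine integral_congr_ae (.of_forall fun θ => ?_)
    simp only [hF, Complex.norm_polarCoord_symm, sq_abs, Complex.real_smul]
    push_cast
    ring
  simp only [hin]
  rw [integral_mul_const, integral_mul_cexp_neg_mul_sq (by simpa using hc)]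
  have : (c : ℂ) ≠ 0 := by exact_mod_cast hc.ne'
  field_simp

theorem integrable_exp_neg_mul_sq_norm {c : ℝ} (hc : 0 < c) :
    Integrable fun z : ℂ => Real.exp (-c * ‖z‖ ^ 2) := by
  have h := (GaussianFourier.integrable_cexp_neg_mul_sq_norm_add (V := ℂ) (b := c)
    (by simpa using hc) 0 0).norm
  refine h.congr (.of_forall fun z => ?_)
  simp [Complex.norm_exp, ← Complex.ofReal_pow]

end GaussianMeanValue

/-! ### Integration over fundamental cells. -/

section FundamentalCell

open MeasureTheory

variable {Γ : Submodule ℤ ℂ} {Λ : Set ℂ}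

instance measurableConstVAdd_lattice (Γ : Submodule ℤ ℂ) : MeasurableConstVAdd Γ ℂ :=
  (inferInstance : MeasurableConstVAdd Γ.toAddSubgroup ℂ)

instance vaddInvariantMeasure_lattice (Γ : Submodule ℤ ℂ) :
    VAddInvariantMeasure Γ ℂ (volume : Measure ℂ) :=
  (inferInstance : VAddInvariantMeasure Γ.toAddSubgroup ℂ (volume : Measure ℂ))

theorem IsFundamentalCell.isAddFundamentalDomain (hΛ : IsFundamentalCell Γ Λ) :
    IsAddFundamentalDomain Γ Λ (volume : Measure ℂ) :=
  .mk' hΛ.measurableSet.nullMeasurableSet fun z => by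
    simpa [Submodule.vadd_def, add_comm] using hΛ.existsUnique_add_mem z

theorem IsFundamentalCell.preimage_add (hΛ : IsFundamentalCell Γ Λ) (a : ℂ) :
    IsFundamentalCell Γ ((fun z => z + a) ⁻¹' Λ) where
  measurableSet := measurable_add_const a hΛ.measurableSet
  existsUnique_add_mem z := by
    simpa [add_right_comm] using hΛ.existsUnique_add_mem (z + a)

/-- A translated cell is again a cell, and a periodic function has the same integral over all cells.
-/
theorem IsFundamentalCell.setIntegral_comp_add (hΛ : IsFundamentalCell Γ Λ) [Countable Γ]
    {f : ℂ → ℂ} (hf : ∀ (γ : Γ) (z : ℂ), f (γ + z) = f z) (a : ℂ) :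
    ∫ z in Λ, f (z + a) = ∫ z in Λ, f z := by
  have h1 : ∫ z in (fun z => z + a) ⁻¹' Λ, f (z + a) = ∫ z in Λ, f z :=
    (measurePreserving_add_right volume a).setIntegral_preimage_emb
      (measurableEmbedding_addRight a) f Λ
  rw [← h1]
  refine hΛ.isAddFundamentalDomain.setIntegral_eq (hΛ.preimage_add a).isAddFundamentalDomain
    fun γ z => ?_
  rw [Submodule.vadd_def, vadd_eq_add, add_assoc, hf]

variable [DiscreteTopology Γ] [IsZLattice ℝ Γ]

theorem IsFundamentalCell.covolume_eq (hΛ : IsFundamentalCell Γ Λ) :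
    ZLattice.covolume Γ = volume.real Λ :=
  ZLattice.covolume_eq_measure_fundamentalDomain Γ volume hΛ.isAddFundamentalDomain

theorem IsFundamentalCell.measure_ne_top (hΛ : IsFundamentalCell Γ Λ) :
    (volume : Measure ℂ) Λ ≠ ⊤ := fun h => by
  -- The real-valued measure sends `⊤` to `0`, whereas the covolume is nonzero.
  have h1 := ZLattice.covolume_ne_zero Γ (volume : Measure ℂ)
  rw [hΛ.covolume_eq, Measure.real, h] at h1
  exact h1 rfl

theorem IsFundamentalCell.isFiniteMeasure_restrict (hΛ : IsFundamentalCell Γ Λ) :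
    IsFiniteMeasure ((volume : Measure ℂ).restrict Λ) :=
  MeasureTheory.isFiniteMeasure_restrict.2 hΛ.measure_ne_top

end FundamentalCell

/-! ### Theta functions and the reproducing property. -/

section ThetaFunctions

open MeasureTheory

variable {ν : ℝ} {Γ : Submodule ℤ ℂ} {χ : Γ → Circle} {Λ : Set ℂ} {f : ℂ → ℂ}

/-- Entire functions with the automorphy of the theta Bargmann-Fock space. -/
structure IsThetaFunction (ν : ℝ) (Γ : Submodule ℤ ℂ) (χ : Γ → Circle) (f : ℂ → ℂ) : Prop where
  differentiable : Differentiable ℂ f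
  apply_add : ∀ (z : ℂ) (γ : Γ), f (z + γ) =
    (χ γ : ℂ) * Complex.exp ((ν : ℂ) * (z + (γ : ℂ) / 2) * conj (γ : ℂ)) * f z

theorem IsThetaFunction.norm_weight_add (hf : IsThetaFunction ν Γ χ f) (z : ℂ) (γ : Γ) :
    Real.exp (-(ν / 2) * ‖z + γ‖ ^ 2) * ‖f (z + γ)‖ = Real.exp (-(ν / 2) * ‖z‖ ^ 2) * ‖f z‖ := by
  rw [hf.apply_add, norm_mul, norm_mul, Circle.norm_coe, one_mul, ← mul_assoc, Complex.norm_exp,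
    ← Real.exp_add]
  congr 2
  simp only [Complex.sq_norm, Complex.normSq_apply, Complex.add_re, Complex.mul_re,
    Complex.add_im, Complex.mul_im, Complex.conj_re, Complex.conj_im,
    Complex.ofReal_re, Complex.ofReal_im, Complex.div_ofNat_re, Complex.div_ofNat_im]
  ring

/-- The unfolding identity: translating the Bargmann integrand by `γ` produces the `γ`-th term of `K
w z`. -/
theorem IsThetaFunction.bargmann_add (hf : IsThetaFunction ν Γ χ f)
    (w z : ℂ) (γ : Γ) :
    f (γ + z) * Complex.exp (ν * w * conj (γ + z)) * (Real.exp (-ν * ‖γ + z‖ ^ 2) : ℝ) =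
      f z * (Real.exp (-ν * ‖z‖ ^ 2) : ℝ) * thetaKernelTerm ν Γ χ w z γ := by
  rw [add_comm (γ : ℂ) z, hf.apply_add, thetaKernelTerm]
  have e : ∀ a b c d e : ℂ, a + b + c = d + e → χ γ * Complex.exp a * f z * Complex.exp b *
      Complex.exp c = f z * Complex.exp d * (χ γ * Complex.exp e) := by
    intro a b c d e h
    have : Complex.exp a * Complex.exp b * Complex.exp c = Complex.exp d * Complex.exp e := by
      rw [← Complex.exp_add, ← Complex.exp_add, h, Complex.exp_add]
    linear_combination (χ γ * f z : ℂ) * this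
  push_cast
  apply e
  simp only [← Complex.mul_conj', map_add]
  ring

variable [DiscreteTopology Γ] [IsZLattice ℝ Γ]

/-- The weighted modulus is continuous and `Γ`-periodic, and the torus is compact. -/
theorem IsThetaFunction.exists_norm_weight_le (hf : IsThetaFunction ν Γ χ f) :
    ∃ C, ∀ z, Real.exp (-(ν / 2) * ‖z‖ ^ 2) * ‖f z‖ ≤ C := by
  have hc := hf.differentiable.continuous
  have h := IsZLattice.isCompact_range_of_periodic Γ
    (fun z => Real.exp (-(ν / 2) * ‖z‖ ^ 2) * ‖f z‖) (by fun_prop)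
    fun z w hw => hf.norm_weight_add z ⟨w, hw⟩
  obtain ⟨C, hC⟩ := h.bddAbove
  exact ⟨C, fun z => hC ⟨z, rfl⟩⟩

/-- Square integrability is automatic: the weighted modulus is bounded and the cell has finite area.
-/
theorem mem_thetaSpace_iff (hΛ : IsFundamentalCell Γ Λ) :
    f ∈ thetaSpace ν Γ χ Λ ↔ IsThetaFunction ν Γ χ f := by
  refine ⟨fun h => ⟨h.1, h.2.1⟩, fun h => ⟨h.1, h.2, ?_⟩⟩
  have := hΛ.isFiniteMeasure_restrict
  have hc := h.differentiable.continuous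
  obtain ⟨C, hC⟩ := h.exists_norm_weight_le
  refine MemLp.of_bound (Continuous.aestronglyMeasurable (by fun_prop)) C (.of_forall fun z => ?_)
  rw [norm_mul, Complex.norm_of_nonneg (Real.exp_pos _).le]
  exact hC z

theorem isThetaFunction_kernelSection (hν : 0 < ν) (hχ : IsPseudoCharacter ν Γ χ) (w : ℂ) :
    IsThetaFunction ν Γ χ (kernelSection ν Γ χ w) :=
  ⟨differentiable_kernelSection hν w, fun z γ => thetaKernel_add hχ z w γ⟩

theorem IsThetaFunction.integrable_bargmann (hν : 0 < ν) (hf : IsThetaFunction ν Γ χ f) (w : ℂ) :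
    Integrable fun z : ℂ =>
      f z * Complex.exp (ν * w * conj z) * (Real.exp (-ν * ‖z‖ ^ 2) : ℝ) := by
  obtain ⟨C, hC⟩ := hf.exists_norm_weight_le
  have hc := hf.differentiable.continuous
  have hconj : Continuous fun z : ℂ => conj z := Complex.continuous_conj
  refine Integrable.mono' ((integrable_exp_neg_mul_sq_norm (c := ν / 4) (by positivity)).const_mul
    (C * Real.exp (ν * ‖w‖ ^ 2))) (Continuous.aestronglyMeasurable (by fun_prop))
    (.of_forall fun z => ?_)
  -- Splitting `‖w‖ * ‖z‖` this way spends only half of the decay `exp (-(ν / 2) * ‖z‖ ^ 2)` that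
  -- remains once `f` is bounded.
  have hre : (ν * w * conj z).re ≤ ν * ‖w‖ ^ 2 + ν / 4 * ‖z‖ ^ 2 := by
    have h1 : (ν * w * conj z).re ≤ ν * (‖w‖ * ‖z‖) := by
      refine (Complex.re_le_norm _).trans (le_of_eq ?_)
      rw [norm_mul, norm_mul, Complex.norm_of_nonneg hν.le, RCLike.norm_conj, mul_assoc]
    nlinarith [mul_nonneg hν.le (sq_nonneg (‖w‖ - ‖z‖ / 2))]
  rw [norm_mul, norm_mul, Complex.norm_of_nonneg (Real.exp_pos _).le, Complex.norm_exp]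
  calc ‖f z‖ * Real.exp (ν * w * conj z).re * Real.exp (-ν * ‖z‖ ^ 2)
      ≤ ‖f z‖ * Real.exp (ν * ‖w‖ ^ 2 + ν / 4 * ‖z‖ ^ 2) * Real.exp (-ν * ‖z‖ ^ 2) := by gcongr
    _ = (Real.exp (-(ν / 2) * ‖z‖ ^ 2) * ‖f z‖) * (Real.exp (ν * ‖w‖ ^ 2) *
          Real.exp (-(ν / 4) * ‖z‖ ^ 2)) := by
      rw [mul_assoc, mul_comm (Real.exp (-(ν / 2) * ‖z‖ ^ 2)), mul_assoc, ← Real.exp_add,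
        ← Real.exp_add, ← Real.exp_add]
      ring_nf
    _ ≤ C * (Real.exp (ν * ‖w‖ ^ 2) * Real.exp (-(ν / 4) * ‖z‖ ^ 2)) := by
      gcongr
      exact hC z
    _ = _ := by ring

/-- After the shift `z = w + u` the antiholomorphic exponential cancels, leaving an entire function
of `u` against a centred Gaussian. -/
theorem IsThetaFunction.integral_bargmann (hν : 0 < ν) (hf : IsThetaFunction ν Γ χ f) (w : ℂ) :
    ∫ z : ℂ, f z * Complex.exp (ν * w * conj z) * (Real.exp (-ν * ‖z‖ ^ 2) : ℝ) =
      Real.pi / ν * f w := by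
  have hshift : ∀ u : ℂ, f (w + u) * Complex.exp (ν * w * conj (w + u)) *
      (Real.exp (-ν * ‖w + u‖ ^ 2) : ℝ) =
      f (w + u) * Complex.exp (-ν * conj w * u) * (Real.exp (-ν * ‖u‖ ^ 2) : ℝ) := by
    intro u
    push_cast
    simp only [mul_assoc (f _), ← Complex.exp_add]
    congr 2
    simp only [← Complex.mul_conj', map_add]
    ring
  have hI := (hf.integrable_bargmann hν w).comp_add_left w
  rw [← integral_add_left_eq_self _ w]
  simp only [hshift] at hI ⊢
  have hd := hf.differentiable
  rw [Differentiable.integral_mul_gaussian (by fun_prop) hν hI]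
  simp

/-- The kernel reproduces the functions of the theta Bargmann-Fock space. -/
theorem IsThetaFunction.integral_mul_thetaKernel (hν : 0 < ν)
    (hΛ : IsFundamentalCell Γ Λ) (hf : IsThetaFunction ν Γ χ f) (w : ℂ) :
    ∫ z in Λ, f z * (Real.exp (-ν * ‖z‖ ^ 2) : ℝ) * thetaKernel ν Γ χ w z = f w := by
  have hI := hf.integrable_bargmann hν w
  have hfd := hΛ.isAddFundamentalDomain
  have h1 := hfd.integral_eq_tsum'' _ hI
  -- The same unfolding for norms supplies the bound that permits exchanging sum and integral.
  have h2 := hfd.lintegral_eq_tsum'' fun z : ℂ =>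
    ‖f z * Complex.exp (ν * w * conj z) * (Real.exp (-ν * ‖z‖ ^ 2) : ℝ)‖ₑ
  simp only [Submodule.vadd_def, vadd_eq_add, hf.bargmann_add] at h1 h2
  have hc := hf.differentiable.continuous
  have hconj : Continuous fun z : ℂ => conj z := Complex.continuous_conj
  rw [hf.integral_bargmann hν, ← integral_tsum] at h1
  · have hν' : (ν : ℂ) ≠ 0 := by exact_mod_cast hν.ne'
    have hpi : (Real.pi : ℂ) ≠ 0 := by exact_mod_cast Real.pi_ne_zero
    have h3 : f w = ν / Real.pi * (Real.pi / ν * f w) := by field_simp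
    rw [h3, h1, ← integral_const_mul]
    refine integral_congr_ae (.of_forall fun z => ?_)
    simp only [thetaKernel, tsum_mul_left]
    ring
  · intro γ
    refine Continuous.aestronglyMeasurable ?_
    unfold thetaKernelTerm
    fun_prop
  · rw [← h2]
    exact hI.2.ne

end ThetaFunctions

noncomputable section

/-! ### The trace of the kernel. -/

section Trace

open MeasureTheory

variable {ν : ℝ} {Γ : Submodule ℤ ℂ} {χ : Γ → Circle} {Λ : Set ℂ}

/-- The unitary character of `ℂ` attached to `a` by the symplectic form. -/
def symplecticCharacter (ν : ℝ) (a z : ℂ) : ℂ :=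
  Complex.exp ((ν : ℂ) * (z * conj a - conj z * a))

theorem symplecticCharacter_add (a z w : ℂ) :
    symplecticCharacter ν a (z + w) = symplecticCharacter ν a z * symplecticCharacter ν a w := by
  simp only [symplecticCharacter, ← Complex.exp_add, map_add]
  ring_nf

theorem norm_symplecticCharacter (a z : ℂ) : ‖symplecticCharacter ν a z‖ = 1 := by
  rw [symplecticCharacter, Complex.norm_exp]
  simp [Complex.mul_re, Complex.sub_re]

theorem continuous_symplecticCharacter (a : ℂ) : Continuous (symplecticCharacter ν a) := by
  have hconj : Continuous fun z : ℂ => conj z := Complex.continuous_conj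
  unfold symplecticCharacter
  fun_prop

theorem exists_symplecticCharacter_eq_neg_one (hν : ν ≠ 0) {a : ℂ} (ha : a ≠ 0) :
    ∃ z, symplecticCharacter ν a z = -1 := by
  -- Chosen so that `z * conj a - conj z * a = π i / ν`.
  refine ⟨(Real.pi / (2 * ν * (a * conj a)) : ℂ) * (Complex.I * a), ?_⟩
  have hν' : (ν : ℂ) ≠ 0 := by exact_mod_cast hν
  have ha' : conj a ≠ 0 := (map_ne_zero _).2 ha
  rw [symplecticCharacter, ← Complex.exp_pi_mul_I]
  congr 1
  simp only [map_mul, map_div₀, Complex.conj_ofReal, Complex.conj_conj, map_ofNat, Complex.conj_I]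
  field_simp
  ring

/-- The character is `Γ`-periodic; translating by a point where it equals `-1` shows that its
integral is its own negative. -/
theorem IsFundamentalCell.setIntegral_symplecticCharacter [Countable Γ] (hν : ν ≠ 0)
    (hχ : IsPseudoCharacter ν Γ χ) (hΛ : IsFundamentalCell Γ Λ) {γ : Γ} (hγ : γ ≠ 0) :
    ∫ z in Λ, symplecticCharacter ν γ z = 0 := by
  obtain ⟨a, ha⟩ := exists_symplecticCharacter_eq_neg_one hν (a := (γ : ℂ)) (by simpa using hγ)
  have h := hΛ.setIntegral_comp_add (f := symplecticCharacter ν γ) (fun δ z => by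
    rw [symplecticCharacter_add, symplecticCharacter, hχ.exp_symplectic_eq_one δ γ, one_mul]) a
  simp only [symplecticCharacter_add, ha, mul_neg_one, integral_neg] at h
  exact self_eq_neg.1 h.symm

theorem thetaKernelTerm_self_mul_weight (w : ℂ) (γ : Γ) :
    thetaKernelTerm ν Γ χ w w γ * (Real.exp (-ν * ‖w‖ ^ 2) : ℝ) =
      χ γ * (Real.exp (-(ν / 2) * ‖(γ : ℂ)‖ ^ 2) : ℝ) * symplecticCharacter ν γ w := by
  rw [thetaKernelTerm, symplecticCharacter]
  push_cast
  rw [mul_assoc, mul_assoc, ← Complex.exp_add, ← Complex.exp_add]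
  simp only [← Complex.mul_conj']
  ring_nf

/-- On the diagonal the weighted kernel is a series of characters, so its integral can be read off
from the term `γ = 0`. -/
theorem thetaKernel_self_mul_weight (w : ℂ) :
    thetaKernel ν Γ χ w w * (Real.exp (-ν * ‖w‖ ^ 2) : ℝ) = ν / Real.pi *
      ∑' γ : Γ, (χ γ : ℂ) * (Real.exp (-(ν / 2) * ‖(γ : ℂ)‖ ^ 2) : ℝ) * symplecticCharacter ν γ w := by
  rw [thetaKernel, mul_assoc, ← tsum_mul_right]
  simp only [thetaKernelTerm_self_mul_weight]

theorem norm_diagonalTerm (w : ℂ) (γ : Γ) :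
    ‖(χ γ : ℂ) * (Real.exp (-(ν / 2) * ‖(γ : ℂ)‖ ^ 2) : ℝ) * symplecticCharacter ν γ w‖ =
      Real.exp (-(ν / 2) * ‖(γ : ℂ)‖ ^ 2) := by
  rw [norm_mul, norm_mul, norm_symplecticCharacter, Circle.norm_coe,
    Complex.norm_of_nonneg (Real.exp_pos _).le, one_mul, mul_one]

variable [DiscreteTopology Γ] [IsZLattice ℝ Γ]

theorem summable_exp_neg_mul_norm_sq (Γ : Submodule ℤ ℂ) [DiscreteTopology Γ] [IsZLattice ℝ Γ]
    {c : ℝ} (hc : 0 < c) : Summable fun γ : Γ => Real.exp (-c * ‖(γ : ℂ)‖ ^ 2) := by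
  simpa using summable_exp_neg_mul_norm_sub_sq Γ hc 0

theorem integrableOn_thetaKernel_self (hν : 0 < ν) (hΛ : IsFundamentalCell Γ Λ) :
    IntegrableOn (fun w => thetaKernel ν Γ χ w w * (Real.exp (-ν * ‖w‖ ^ 2) : ℝ)) Λ := by
  have := hΛ.isFiniteMeasure_restrict
  simp only [thetaKernel_self_mul_weight]
  refine Integrable.const_mul ?_ _
  have hs := summable_exp_neg_mul_norm_sq Γ (half_pos hν)
  refine Integrable.of_bound (Continuous.aestronglyMeasurable ?_)
    (∑' γ : Γ, Real.exp (-(ν / 2) * ‖(γ : ℂ)‖ ^ 2)) (.of_forall fun w => ?_)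
  · exact continuous_tsum (fun γ => (continuous_symplecticCharacter _).const_mul _) hs
      fun γ w => (norm_diagonalTerm w γ).le
  · exact tsum_of_norm_bounded hs.hasSum fun γ => (norm_diagonalTerm w γ).le

theorem setIntegral_thetaKernel_self (hν : 0 < ν) (hχ : IsPseudoCharacter ν Γ χ)
    (hΛ : IsFundamentalCell Γ Λ) :
    ∫ w in Λ, thetaKernel ν Γ χ w w * (Real.exp (-ν * ‖w‖ ^ 2) : ℝ) =
      (ν / Real.pi * ZLattice.covolume Γ : ℝ) := by
  have := hΛ.isFiniteMeasure_restrict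
  simp only [thetaKernel_self_mul_weight]
  rw [integral_const_mul, ← integral_tsum_of_summable_integral_norm, tsum_eq_single 0]
  · simp only [ZeroMemClass.coe_zero, hχ.map_zero, symplecticCharacter]
    simp [hΛ.covolume_eq]
  · intro γ hγ
    rw [integral_const_mul, hΛ.setIntegral_symplecticCharacter hν.ne' hχ hγ, mul_zero]
  · intro γ
    refine Integrable.const_mul ?_ _
    exact Integrable.of_bound (continuous_symplecticCharacter _).aestronglyMeasurable 1
      (.of_forall fun w => (norm_symplecticCharacter _ _).le)
  · simp only [norm_diagonalTerm, integral_const, smul_eq_mul]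
    exact (summable_exp_neg_mul_norm_sq Γ (half_pos hν)).mul_left _

end Trace

/-! ### The dimension formula. -/

section Dimension

open MeasureTheory

variable {ν : ℝ} {Γ : Submodule ℤ ℂ} {χ : Γ → Circle} {Λ : Set ℂ}

/-- The isometry of the theta Bargmann-Fock space into `L²` of the cell. -/
def thetaSpaceToLp (ν : ℝ) (Γ : Submodule ℤ ℂ) (χ : Γ → Circle) (Λ : Set ℂ) :
    thetaSpace ν Γ χ Λ →ₗ[ℂ] Lp ℂ 2 ((volume : Measure ℂ).restrict Λ) where
  toFun f := f.2.2.2.toLp _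
  map_add' f g := by
    rw [← MemLp.toLp_add]
    congr 1
    funext z
    simp [mul_add]
  map_smul' c f := by
    rw [RingHom.id_apply, ← MemLp.toLp_const_smul]
    congr 1
    funext z
    simp
    ring

theorem inner_thetaSpaceToLp (f g : thetaSpace ν Γ χ Λ) :
    inner ℂ (thetaSpaceToLp ν Γ χ Λ f) (thetaSpaceToLp ν Γ χ Λ g) =
      ∫ z in Λ, conj ((f : ℂ → ℂ) z) * (g : ℂ → ℂ) z * (Real.exp (-ν * ‖z‖ ^ 2) : ℝ) := by
  rw [L2.inner_def]
  refine integral_congr_ae ?_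
  filter_upwards [f.2.2.2.coeFn_toLp, g.2.2.2.coeFn_toLp] with z hf hg
  have h1 : (thetaSpaceToLp ν Γ χ Λ f) z = _ := hf
  have h2 : (thetaSpaceToLp ν Γ χ Λ g) z = _ := hg
  rw [h1, h2, RCLike.inner_apply, map_mul, Complex.conj_ofReal]
  have : Real.exp (-ν * ‖z‖ ^ 2) = Real.exp (-(ν / 2) * ‖z‖ ^ 2) * Real.exp (-(ν / 2) * ‖z‖ ^ 2) := by
    rw [← Real.exp_add]
    ring_nf
  rw [this]
  push_cast
  ring

theorem norm_thetaSpaceToLp_sq (f : thetaSpace ν Γ χ Λ) :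
    ‖thetaSpaceToLp ν Γ χ Λ f‖ ^ 2 =
      ∫ z in Λ, ‖(f : ℂ → ℂ) z‖ ^ 2 * Real.exp (-ν * ‖z‖ ^ 2) := by
  have h := inner_thetaSpaceToLp f f
  rw [inner_self_eq_norm_sq_to_K] at h
  have h2 : ∀ z, conj ((f : ℂ → ℂ) z) * (f : ℂ → ℂ) z * (Real.exp (-ν * ‖z‖ ^ 2) : ℝ) =
      ((‖(f : ℂ → ℂ) z‖ ^ 2 * Real.exp (-ν * ‖z‖ ^ 2) : ℝ) : ℂ) := fun z => by
    rw [mul_comm (conj _), Complex.mul_conj']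
    push_cast
    ring
  simp only [h2, integral_complex_ofReal] at h
  refine Complex.ofReal_injective ?_
  rw [Complex.ofReal_pow]
  exact h

theorem integrableOn_norm_sq_mul_weight (f : thetaSpace ν Γ χ Λ) :
    IntegrableOn (fun z => ‖(f : ℂ → ℂ) z‖ ^ 2 * Real.exp (-ν * ‖z‖ ^ 2)) Λ := by
  refine (f.2.2.2.integrable_norm_pow (by norm_num)).congr (.of_forall fun z => ?_)
  simp only [norm_mul, Complex.norm_of_nonneg (Real.exp_pos _).le, mul_pow]
  rw [← Real.exp_nat_mul, mul_comm]
  push_cast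
  ring_nf

variable [DiscreteTopology Γ] [IsZLattice ℝ Γ]

theorem kernelSection_mem_thetaSpace (hν : 0 < ν) (hχ : IsPseudoCharacter ν Γ χ)
    (hΛ : IsFundamentalCell Γ Λ) (w : ℂ) : kernelSection ν Γ χ w ∈ thetaSpace ν Γ χ Λ :=
  (mem_thetaSpace_iff hΛ).2 (isThetaFunction_kernelSection hν hχ w)

theorem inner_kernelSection (hν : 0 < ν) (hχ : IsPseudoCharacter ν Γ χ)
    (hΛ : IsFundamentalCell Γ Λ) (f : thetaSpace ν Γ χ Λ) (w : ℂ) :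
    inner ℂ (thetaSpaceToLp ν Γ χ Λ ⟨_, kernelSection_mem_thetaSpace hν hχ hΛ w⟩)
      (thetaSpaceToLp ν Γ χ Λ f) = (f : ℂ → ℂ) w := by
  rw [inner_thetaSpaceToLp,
    ← ((mem_thetaSpace_iff hΛ).1 f.2).integral_mul_thetaKernel hν hΛ w]
  refine integral_congr_ae (.of_forall fun z => ?_)
  simp only [kernelSection, conj_thetaKernel hχ]
  ring

theorem thetaSpaceToLp_injective (hν : 0 < ν) (hχ : IsPseudoCharacter ν Γ χ)
    (hΛ : IsFundamentalCell Γ Λ) : Function.Injective (thetaSpaceToLp ν Γ χ Λ) := by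
  rw [injective_iff_map_eq_zero]
  intro f hf
  ext w
  rw [← inner_kernelSection hν hχ hΛ f w, hf, inner_zero_right]
  rfl

theorem norm_sq_kernelSection (hν : 0 < ν) (hχ : IsPseudoCharacter ν Γ χ)
    (hΛ : IsFundamentalCell Γ Λ) (w : ℂ) :
    thetaKernel ν Γ χ w w = ((‖thetaSpaceToLp ν Γ χ Λ
      ⟨_, kernelSection_mem_thetaSpace hν hχ hΛ w⟩‖ ^ 2 : ℝ) : ℂ) := by
  have h := inner_kernelSection hν hχ hΛ ⟨_, kernelSection_mem_thetaSpace hν hχ hΛ w⟩ w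
  rw [inner_self_eq_norm_sq_to_K] at h
  rw [Complex.ofReal_pow]
  exact h.symm

/-- A finite-dimensional space of theta functions has dimension at most `ν / π` times the area of
the cell, with equality for the whole space. -/
theorem finrank_le_of_le_range_thetaSpaceToLp (hν : 0 < ν) (hχ : IsPseudoCharacter ν Γ χ)
    (hΛ : IsFundamentalCell Γ Λ) (U : Submodule ℂ (Lp ℂ 2 ((volume : Measure ℂ).restrict Λ)))
    [FiniteDimensional ℂ U] (hU : U ≤ LinearMap.range (thetaSpaceToLp ν Γ χ Λ)) :
    (Module.finrank ℂ U : ℝ) ≤ ν / Real.pi * ZLattice.covolume Γ ∧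
      (U = LinearMap.range (thetaSpaceToLp ν Γ χ Λ) →
        (Module.finrank ℂ U : ℝ) = ν / Real.pi * ZLattice.covolume Γ) := by
  set b := stdOrthonormalBasis ℂ U
  choose f hf using fun i => hU (b i).2
  set k : ℂ → Lp ℂ 2 ((volume : Measure ℂ).restrict Λ) := fun w =>
    thetaSpaceToLp ν Γ χ Λ ⟨_, kernelSection_mem_thetaSpace hν hχ hΛ w⟩ with hk
  have hbk : ∀ i w, ‖inner ℂ (b i : Lp ℂ 2 ((volume : Measure ℂ).restrict Λ)) (k w)‖ =
      ‖(f i : ℂ → ℂ) w‖ := fun i w => by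
    rw [norm_inner_symm, ← hf i, hk, inner_kernelSection hν hχ hΛ]
  have horth : Orthonormal ℂ fun i => (b i : Lp ℂ 2 ((volume : Measure ℂ).restrict Λ)) :=
    b.orthonormal.comp_linearIsometry U.subtypeₗᵢ
  have hcard : ∫ w in Λ, ∑ i, ‖(f i : ℂ → ℂ) w‖ ^ 2 * Real.exp (-ν * ‖w‖ ^ 2) =
      Module.finrank ℂ U := by
    rw [integral_finsetSum _ fun i _ => integrableOn_norm_sq_mul_weight (f i)]
    have h1 : ∀ i, ‖thetaSpaceToLp ν Γ χ Λ (f i)‖ = 1 := fun i => by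
      rw [hf i]
      exact horth.1 i
    simp only [← norm_thetaSpaceToLp_sq, h1]
    simp
  have htrace : ∫ w in Λ, ‖k w‖ ^ 2 * Real.exp (-ν * ‖w‖ ^ 2) =
      ν / Real.pi * ZLattice.covolume Γ := by
    have h := setIntegral_thetaKernel_self hν hχ hΛ
    simp only [norm_sq_kernelSection hν hχ hΛ, ← Complex.ofReal_mul] at h
    rw [integral_complex_ofReal] at h
    exact_mod_cast h
  have hkint : IntegrableOn (fun w => ‖k w‖ ^ 2 * Real.exp (-ν * ‖w‖ ^ 2)) Λ := by
    have h := integrableOn_thetaKernel_self (χ := χ) hν hΛ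
    simp only [norm_sq_kernelSection hν hχ hΛ, ← Complex.ofReal_mul] at h
    exact h.re
  rw [← hcard, ← htrace]
  constructor
  · refine integral_mono (integrable_finsetSum _ fun i _ => integrableOn_norm_sq_mul_weight (f i))
      hkint fun w => ?_
    simp only [← hbk, ← Finset.sum_mul]
    gcongr
    -- Bessel's inequality for the kernel vector, pointwise in `w`.
    exact horth.sum_inner_products_le (k w)
  · intro hUeq
    refine integral_congr_ae (.of_forall fun w => ?_)
    simp only [← hbk, ← Finset.sum_mul]
    congr 1
    -- When `U` is the whole image it contains the kernel vectors, and Bessel becomes Parseval.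
    have hkU : k w ∈ U := hUeq ▸ LinearMap.mem_range_self _ _
    exact b.sum_sq_norm_inner_right ⟨k w, hkU⟩

/-- The trace bound applies to the span of every finite independent family, so it bounds the rank
without any prior finiteness. -/
theorem finiteDimensional_thetaSpace (hν : 0 < ν) (hχ : IsPseudoCharacter ν Γ χ)
    (hΛ : IsFundamentalCell Γ Λ) : FiniteDimensional ℂ (thetaSpace ν Γ χ Λ) := by
  have hinj := thetaSpaceToLp_injective hν hχ hΛ
  have h : Module.rank ℂ (thetaSpace ν Γ χ Λ) ≤ ⌊ν / Real.pi * ZLattice.covolume Γ⌋₊ := by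
    refine rank_le fun s hs => Nat.le_floor ?_
    have h1 := (finrank_le_of_le_range_thetaSpaceToLp hν hχ hΛ
      ((Submodule.span ℂ (s : Set (thetaSpace ν Γ χ Λ))).map (thetaSpaceToLp ν Γ χ Λ))
      LinearMap.map_le_range).1
    rwa [← (Submodule.equivMapOfInjective _ hinj _).finrank_eq, finrank_span_finset_eq_card hs] at h1
  exact Module.rank_lt_aleph0_iff.1 (h.trans_lt Cardinal.natCast_lt_aleph0)

theorem finrank_thetaSpace (hν : 0 < ν) (hχ : IsPseudoCharacter ν Γ χ)
    (hΛ : IsFundamentalCell Γ Λ) :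
    (Module.finrank ℂ (thetaSpace ν Γ χ Λ) : ℝ) = ν / Real.pi * ZLattice.covolume Γ := by
  have := finiteDimensional_thetaSpace hν hχ hΛ
  have h := (finrank_le_of_le_range_thetaSpaceToLp hν hχ hΛ _ le_rfl).2 rfl
  rwa [LinearMap.finrank_range_of_inj (thetaSpaceToLp_injective hν hχ hΛ)] at h

end Dimension
end

noncomputable section

/-! ### Concentration of the kernels of high tensor powers. -/

section KernelAsymptotics

open Filter Topology

variable {ν : ℝ} {Γ : Submodule ℤ ℂ} {χ : Γ → Circle}

theorem norm_weight_mul_thetaKernelTerm (z w : ℂ) (γ : Γ) :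
    ‖(Real.exp (-(ν / 2) * (‖z‖ ^ 2 + ‖w‖ ^ 2)) : ℂ) * thetaKernelTerm ν Γ χ z w γ‖ =
      Real.exp (-(ν / 2) * ‖(γ : ℂ) - (z - w)‖ ^ 2) := by
  rw [norm_mul, norm_thetaKernelTerm, Complex.norm_of_nonneg (Real.exp_pos _).le, ← mul_assoc,
    ← Real.exp_add]
  simp

theorem weight_mul_thetaKernelTerm_zero (hχ : IsPseudoCharacter ν Γ χ) (z : ℂ) :
    (Real.exp (-(ν / 2) * (‖z‖ ^ 2 + ‖z‖ ^ 2)) : ℂ) * thetaKernelTerm ν Γ χ z z 0 = 1 := by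
  rw [thetaKernelTerm, hχ.map_zero]
  push_cast
  rw [one_mul, ← Complex.exp_add, Complex.exp_eq_one_iff]
  refine ⟨0, ?_⟩
  simp only [← Complex.mul_conj']
  simp
  ring

variable [DiscreteTopology Γ] [IsZLattice ℝ Γ]

/-- Off the lattice translates of the diagonal the kernels of the tensor powers concentrate on the
diagonal. -/
theorem tendsto_weight_mul_tsum_thetaKernelTerm (hν : 0 < ν) (hχ : IsPseudoCharacter ν Γ χ)
    {z w : ℂ} (hzw : z - w ∈ Γ → z = w) :
    Tendsto (fun k : ℕ => (Real.exp (-(k * ν / 2) * (‖z‖ ^ 2 + ‖w‖ ^ 2)) : ℂ) *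
      ∑' γ : Γ, thetaKernelTerm (k * ν) Γ (χ ^ k) z w γ) atTop (𝓝 (if z = w then 1 else 0)) := by
  simp only [← tsum_mul_left]
  -- The limit is taken termwise: a term survives only if `γ = z - w`, which the hypothesis allows
  -- only for `γ = 0`.
  have hlim : (if z = w then 1 else 0 : ℂ) = ∑' γ : Γ, if (γ : ℂ) = z - w then (1 : ℂ) else 0 := by
    by_cases h : z = w
    · simp [h]
    · rw [if_neg h]
      have h0 : ∀ γ : Γ, (γ : ℂ) ≠ z - w := fun γ hγ => h (hzw (hγ ▸ γ.2))
      simp [h0]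
  rw [hlim]
  refine tendsto_tsum_of_dominated_convergence
    (summable_exp_neg_mul_norm_sub_sq Γ (half_pos hν) (z - w)) (fun γ => ?_) ?_
  · split_ifs with hγ
    · obtain rfl : z = w := hzw (hγ ▸ γ.2)
      obtain rfl : γ = 0 := Subtype.ext (by simpa using hγ)
      refine tendsto_const_nhds.congr fun k => ?_
      exact (weight_mul_thetaKernelTerm_zero (hχ.pow k) z).symm
    · rw [tendsto_zero_iff_norm_tendsto_zero]
      simp only [norm_weight_mul_thetaKernelTerm]
      have hpos : 0 < ν / 2 * ‖(γ : ℂ) - (z - w)‖ ^ 2 := by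
        have := norm_pos_iff.2 (sub_ne_zero.2 hγ)
        positivity
      refine (Real.tendsto_exp_neg_atTop_nhds_zero.comp
        (tendsto_natCast_atTop_atTop.atTop_mul_const hpos)).congr fun k => ?_
      simp only [Function.comp_apply]
      ring_nf
  -- For `k ≥ 1` each Gaussian is dominated by that of level `1`.
  · filter_upwards [eventually_ge_atTop 1] with k hk γ
    rw [norm_weight_mul_thetaKernelTerm]
    have hk' : (1 : ℝ) ≤ k := by exact_mod_cast hk
    refine Real.exp_le_exp.2 (mul_le_mul_of_nonneg_right ?_ (by positivity))
    nlinarith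

end KernelAsymptotics

/-! ### Counting zeros and the set `Ξ`. -/

section Zeros

open Filter Topology

variable {ν : ℝ} {Γ : Submodule ℤ ℂ} {χ : Γ → Circle} {Λ : Set ℂ}

theorem IsThetaFunction.mul {f g : ℂ → ℂ} {k : ℕ} (hf : IsThetaFunction ν Γ χ f)
    (hg : IsThetaFunction (k * ν) Γ (χ ^ k) g) :
    IsThetaFunction ((k + 1 : ℕ) * ν) Γ (χ ^ (k + 1)) (f * g) where
  differentiable := hf.differentiable.mul hg.differentiable
  apply_add z γ := by
    have h : Complex.exp ((((k + 1 : ℕ) * ν : ℝ) : ℂ) * (z + (γ : ℂ) / 2) * conj (γ : ℂ)) =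
        Complex.exp ((ν : ℂ) * (z + (γ : ℂ) / 2) * conj (γ : ℂ)) *
        Complex.exp (((k * ν : ℝ) : ℂ) * (z + (γ : ℂ) / 2) * conj (γ : ℂ)) := by
      rw [← Complex.exp_add]
      push_cast
      ring_nf
    rw [h]
    simp only [Pi.mul_apply, hf.apply_add, hg.apply_add, Pi.pow_apply, Circle.coe_pow]
    ring

/-- Evaluation at finitely many points. -/
def thetaSpaceEval (ν : ℝ) (Γ : Submodule ℤ ℂ) (χ : Γ → Circle) (Λ : Set ℂ) {ι : Type*}
    (p : ι → ℂ) : thetaSpace ν Γ χ Λ →ₗ[ℂ] ι → ℂ :=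
  (LinearMap.funLeft ℂ ℂ p).comp (thetaSpace ν Γ χ Λ).subtype

theorem thetaSpaceEval_apply {ι : Type*} (p : ι → ℂ) (f : thetaSpace ν Γ χ Λ) (i : ι) :
    thetaSpaceEval ν Γ χ Λ p f i = (f : ℂ → ℂ) (p i) := rfl

theorem IsFundamentalCell.eq_of_sub_mem (hΛ : IsFundamentalCell Γ Λ) {z w : ℂ} (hz : z ∈ Λ)
    (hw : w ∈ Λ) (h : z - w ∈ Γ) : z = w := by
  have := (hΛ.existsUnique_add_mem w).unique (y₁ := 0) (y₂ := ⟨z - w, h⟩) (by simpa) (by simpa)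
  exact sub_eq_zero.1 (congrArg Subtype.val this).symm

variable [DiscreteTopology Γ] [IsZLattice ℝ Γ]

/-- Multiplication by a theta function. -/
def IsThetaFunction.mulLeft (hΛ : IsFundamentalCell Γ Λ) {f : ℂ → ℂ}
    (hf : IsThetaFunction ν Γ χ f) (k : ℕ) :
    thetaSpace (k * ν) Γ (χ ^ k) Λ →ₗ[ℂ] thetaSpace ((k + 1 : ℕ) * ν) Γ (χ ^ (k + 1)) Λ :=
  (LinearMap.mulLeft ℂ f).restrict fun _ hg =>
    (mem_thetaSpace_iff hΛ).2 (hf.mul ((mem_thetaSpace_iff hΛ).1 hg))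

theorem IsThetaFunction.mulLeft_injective (hΛ : IsFundamentalCell Γ Λ) {f : ℂ → ℂ}
    (hf : IsThetaFunction ν Γ χ f) (hf0 : f ≠ 0) (k : ℕ) :
    Function.Injective (hf.mulLeft hΛ k) := by
  rw [injective_iff_map_eq_zero]
  intro g hg
  have hfg : ∀ z ∈ Set.univ, f z * (g : ℂ → ℂ) z = 0 := fun z _ =>
    congrFun (congrArg Subtype.val hg) z
  have hga := ((mem_thetaSpace_iff hΛ).1 g.2).differentiable
  rcases AnalyticOnNhd.eq_zero_or_eq_zero_of_mul_eq_zero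
    (hf.differentiable.differentiableOn.analyticOnNhd isOpen_univ)
    (hga.differentiableOn.analyticOnNhd isOpen_univ) hfg isPreconnected_univ with h | h
  · exact absurd (funext fun z => h z trivial) hf0
  · exact Subtype.ext (funext fun z => h z trivial)

/-- Sections of high tensor powers separate points of the torus. -/
theorem eventually_surjective_thetaSpaceEval (hν : 0 < ν) (hχ : IsPseudoCharacter ν Γ χ)
    (hΛ : IsFundamentalCell Γ Λ) {ι : Type*} [Fintype ι] {p : ι → ℂ}
    (hp : ∀ i j, p i - p j ∈ Γ → i = j) :
    ∀ᶠ k : ℕ in atTop, Function.Surjective (thetaSpaceEval (k * ν) Γ (χ ^ k) Λ p) := by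
  classical
  -- The kernel matrix at the points, weighted and stripped of `kν / π` so that it converges to the
  -- identity.
  set B : ℕ → Matrix ι ι ℂ := fun k => Matrix.of fun i j =>
    (Real.exp (-(k * ν / 2) * (‖p i‖ ^ 2 + ‖p j‖ ^ 2)) : ℂ) *
      ∑' γ : Γ, thetaKernelTerm (k * ν) Γ (χ ^ k) (p i) (p j) γ with hB
  have hpi : ∀ i j, p i = p j ↔ i = j :=
    fun i j => ⟨fun h => hp i j (by simp [h]), fun h => by rw [h]⟩
  have hlim : Tendsto B atTop (𝓝 1) := by
    refine tendsto_pi_nhds.2 fun i => tendsto_pi_nhds.2 fun j => ?_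
    have h := tendsto_weight_mul_tsum_thetaKernelTerm hν hχ (z := p i) (w := p j)
      fun h => (hpi i j).2 (hp i j h)
    simp only [hpi, ← Matrix.one_apply] at h
    exact h
  have hdet : ∀ᶠ k in atTop, (B k).det ≠ 0 := by
    have h := (Continuous.matrix_det continuous_id).continuousAt.tendsto.comp hlim
    refine h.eventually_ne ?_
    simp
  filter_upwards [hdet, eventually_ge_atTop 1] with k hk hk1 y
  have hk0 : 0 < (k : ℝ) * ν := by
    have : (0 : ℝ) < k := by exact_mod_cast hk1
    positivity
  set a : ι → ℂ := fun i => (Real.exp (-(k * ν / 2) * ‖p i‖ ^ 2) : ℝ) with ha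
  have ha0 : ∀ i, a i ≠ 0 := fun i => by
    simpa only [ha, ne_eq, Complex.ofReal_eq_zero] using (Real.exp_pos _).ne'
  have hc0 : ((k * ν : ℝ) : ℂ) / Real.pi ≠ 0 :=
    div_ne_zero (by exact_mod_cast hk0.ne') (by exact_mod_cast Real.pi_ne_zero)
  obtain ⟨x, hx⟩ := (Matrix.mulVec_surjective_iff_isUnit.2
    ((Matrix.isUnit_iff_isUnit_det _).2 hk.isUnit)) fun i => a i * y i
  -- The coefficients restore the weight at `p j` and remove the factor `kν / π`; the weight at `p
  -- i` is cancelled from the equation below.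
  refine ⟨∑ j, (x j * a j / (((k * ν : ℝ) : ℂ) / Real.pi)) •
    ⟨_, kernelSection_mem_thetaSpace hk0 (hχ.pow k) hΛ (p j)⟩, ?_⟩
  funext i
  refine mul_left_cancel₀ (ha0 i) ?_
  rw [← congrFun hx i, map_sum, Finset.sum_apply, Finset.mul_sum, Matrix.mulVec, dotProduct]
  refine Finset.sum_congr rfl fun j _ => ?_
  rw [map_smul, Pi.smul_apply, thetaSpaceEval_apply, smul_eq_mul]
  simp only [kernelSection, thetaKernel, hB, ha, Matrix.of_apply]
  rw [mul_add, Real.exp_add]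
  push_cast at hc0 ⊢
  obtain ⟨hk', hν'⟩ := mul_ne_zero_iff.1 (div_ne_zero_iff.1 hc0).1
  field_simp

/-- A nonzero theta function has at most `ν / π` times the area of the cell zeros modulo the
lattice. -/
theorem card_zeros_le (hν : 0 < ν) (hχ : IsPseudoCharacter ν Γ χ) (hΛ : IsFundamentalCell Γ Λ)
    {f : ℂ → ℂ} (hf : IsThetaFunction ν Γ χ f) (hf0 : f ≠ 0) {ι : Type*} [Fintype ι] {p : ι → ℂ}
    (hp : ∀ i j, p i - p j ∈ Γ → i = j) (hfp : ∀ i, f (p i) = 0) :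
    (Fintype.card ι : ℝ) ≤ ν / Real.pi * ZLattice.covolume Γ := by
  -- Surjectivity is needed at level `k + 1`, while `k ≥ 1` makes the dimension formula available at
  -- level `k`.
  obtain ⟨k, hk1, hk⟩ : ∃ k : ℕ, 1 ≤ k ∧
      Function.Surjective (thetaSpaceEval ((k + 1 : ℕ) * ν) Γ (χ ^ (k + 1)) Λ p) :=
    (((eventually_ge_atTop 1).and
      ((tendsto_add_atTop_nat 1).eventually
        (eventually_surjective_thetaSpaceEval hν hχ hΛ hp)))).exists
  have hk0 : 0 < (k : ℝ) * ν := by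
    have : (0 : ℝ) < k := by exact_mod_cast hk1
    positivity
  have hk0' : 0 < ((k + 1 : ℕ) : ℝ) * ν := by positivity
  have := finiteDimensional_thetaSpace hk0' (hχ.pow (k + 1)) hΛ
  have := finiteDimensional_thetaSpace hk0 (hχ.pow k) hΛ
  have hle : LinearMap.range (hf.mulLeft hΛ k) ≤
      LinearMap.ker (thetaSpaceEval ((k + 1 : ℕ) * ν) Γ (χ ^ (k + 1)) Λ p) := by
    rintro _ ⟨g, rfl⟩
    rw [LinearMap.mem_ker]
    funext i
    change f (p i) * (g : ℂ → ℂ) (p i) = 0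
    rw [hfp, zero_mul]
  have h1 := LinearMap.finrank_range_add_finrank_ker
    (thetaSpaceEval ((k + 1 : ℕ) * ν) Γ (χ ^ (k + 1)) Λ p)
  have h2 := Submodule.finrank_mono hle
  rw [LinearMap.finrank_range_of_inj (hf.mulLeft_injective hΛ hf0 k)] at h2
  rw [LinearMap.range_eq_top.2 hk, finrank_top, Module.finrank_fintype_fun_eq_card] at h1
  -- The evaluation kernel has codimension `card ι` and contains a copy of the space of level `k`.
  have h3 : (Fintype.card ι : ℝ) + Module.finrank ℂ (thetaSpace (k * ν) Γ (χ ^ k) Λ) ≤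
      Module.finrank ℂ (thetaSpace ((k + 1 : ℕ) * ν) Γ (χ ^ (k + 1)) Λ) := by
    rw [← h1]
    exact_mod_cast Nat.add_le_add_left h2 _
  rw [finrank_thetaSpace hk0 (hχ.pow k) hΛ, finrank_thetaSpace hk0' (hχ.pow (k + 1)) hΛ] at h3
  push_cast at h3
  have h4 : ((k : ℝ) + 1) * ν / Real.pi * ZLattice.covolume Γ =
    k * ν / Real.pi * ZLattice.covolume Γ + ν / Real.pi * ZLattice.covolume Γ := by ring
  linarith

/-- A common zero annihilates the kernel sections in particular; conversely the reproducing integral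
for `f w` has integrand zero. -/
theorem iInter_zerosIn_eq_xiSet (hν : 0 < ν) (hχ : IsPseudoCharacter ν Γ χ)
    (hΛ : IsFundamentalCell Γ Λ) :
    (⋂ f ∈ thetaSpace ν Γ χ Λ, zerosIn Λ f) = xiSet ν Γ χ Λ := by
  ext w
  simp only [Set.mem_iInter]
  constructor
  · intro h
    refine ⟨(h 0 (zero_mem _)).1, fun z _ => ?_⟩
    exact (thetaKernel_eq_zero_comm hχ).1 (h _ (kernelSection_mem_thetaSpace hν hχ hΛ z)).2
  · rintro ⟨hw, h⟩ f hf
    refine ⟨hw, ?_⟩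
    rw [← ((mem_thetaSpace_iff hΛ).1 hf).integral_mul_thetaKernel hν hΛ w]
    refine MeasureTheory.setIntegral_eq_zero_of_forall_eq_zero fun z hz => ?_
    rw [(thetaKernel_eq_zero_comm hχ).1 (h z hz), mul_zero]

/-- The dimension formula is positive, so a nonzero `f` exists; the points of `Ξ` are zeros of it,
incongruent because they lie in one cell. -/
theorem card_le_of_subset_xiSet (hν : 0 < ν) (hχ : IsPseudoCharacter ν Γ χ)
    (hΛ : IsFundamentalCell Γ Λ) {s : Finset ℂ} (hs : (s : Set ℂ) ⊆ xiSet ν Γ χ Λ) :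
    s.card ≤ Module.finrank ℂ (thetaSpace ν Γ χ Λ) := by
  have hdim := finrank_thetaSpace hν hχ hΛ
  have hpos : (0 : ℝ) < Module.finrank ℂ (thetaSpace ν Γ χ Λ) := by
    have := ZLattice.covolume_pos Γ (MeasureTheory.volume : MeasureTheory.Measure ℂ)
    have := Real.pi_pos
    rw [hdim]
    positivity
  have := Module.nontrivial_of_finrank_pos (by exact_mod_cast hpos :
    0 < Module.finrank ℂ (thetaSpace ν Γ χ Λ))
  obtain ⟨f, hf⟩ := exists_ne (0 : thetaSpace ν Γ χ Λ)
  have h := card_zeros_le hν hχ hΛ ((mem_thetaSpace_iff hΛ).1 f.2) (fun h => hf (Subtype.ext h))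
    (p := fun i : s => (i : ℂ))
    (fun i j hij => Subtype.ext (hΛ.eq_of_sub_mem (hs i.2).1 (hs j.2).1 hij)) fun i => by
      have hi := hs i.2
      rw [← iInter_zerosIn_eq_xiSet hν hχ hΛ] at hi
      exact (Set.mem_iInter₂.1 hi f f.2).2
  rw [← hdim, Fintype.card_coe] at h
  exact_mod_cast h

theorem finite_xiSet (hν : 0 < ν) (hχ : IsPseudoCharacter ν Γ χ) (hΛ : IsFundamentalCell Γ Λ) :
    (xiSet ν Γ χ Λ).Finite := by
  by_contra h
  obtain ⟨s, hs, hcard⟩ := Set.Infinite.exists_subset_card_eq h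
    (Module.finrank ℂ (thetaSpace ν Γ χ Λ) + 1)
  have := card_le_of_subset_xiSet hν hχ hΛ hs
  omega

theorem ncard_xiSet_le (hν : 0 < ν) (hχ : IsPseudoCharacter ν Γ χ) (hΛ : IsFundamentalCell Γ Λ) :
    (xiSet ν Γ χ Λ).ncard ≤ Module.finrank ℂ (thetaSpace ν Γ χ Λ) := by
  have hfin := finite_xiSet hν hχ hΛ
  rw [Set.ncard_eq_toFinset_card _ hfin]
  exact card_le_of_subset_xiSet hν hχ hΛ (by simp)

end Zeros
end

theorem theorem1 (ν : ℝ) (hν : 0 < ν) (Γ : Submodule ℤ ℂ) [DiscreteTopology Γ]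
    [IsZLattice ℝ Γ] (χ : Γ → Circle) (hχ : IsPseudoCharacter ν Γ χ)
    (Λ : Set ℂ) (hΛ : IsFundamentalCell Γ Λ) :
    -- the series that defines the kernel converges absolutely
    (∀ z w : ℂ, Summable fun γ : Γ => ‖thetaKernelTerm ν Γ χ z w γ‖) ∧
    -- the zero set of the kernel is symmetric
    (∀ z w : ℂ, (z, w) ∈ kernelZeros ν Γ χ ↔ (w, z) ∈ kernelZeros ν Γ χ) ∧
    -- the zeros with at least one coordinate in the cell
    kernelZeros ν Γ χ ∩ {p | p.1 ∈ Λ ∨ p.2 ∈ Λ} =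
      (⋃ w ∈ Λ, (zerosIn Λ (kernelSection ν Γ χ w) + (Γ : Set ℂ)) ×ˢ ({w} : Set ℂ)) ∪
      (⋃ w ∈ Λ, ({w} : Set ℂ) ×ˢ (zerosIn Λ (kernelSection ν Γ χ w) + (Γ : Set ℂ))) ∧
    -- all the zeros
    kernelZeros ν Γ χ =
      (⋃ w ∈ Λ, (zerosIn Λ (kernelSection ν Γ χ w) + (Γ : Set ℂ)) ×ˢ
        (({w} : Set ℂ) + (Γ : Set ℂ))) ∪
      (⋃ w ∈ Λ, (({w} : Set ℂ) + (Γ : Set ℂ)) ×ˢ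
        (zerosIn Λ (kernelSection ν Γ χ w) + (Γ : Set ℂ))) ∧
    -- the common zeros in the cell of the functions of the theta Bargmann-Fock space
    (⋂ f ∈ thetaSpace ν Γ χ Λ, zerosIn Λ f) = xiSet ν Γ χ Λ ∧
    -- finiteness and cardinality
    (xiSet ν Γ χ Λ).Finite ∧
    FiniteDimensional ℂ (thetaSpace ν Γ χ Λ) ∧
    (xiSet ν Γ χ Λ).ncard ≤ Module.finrank ℂ (thetaSpace ν Γ χ Λ) ∧
    (Module.finrank ℂ (thetaSpace ν Γ χ Λ) : ℝ) =
      ν / Real.pi * ZLattice.covolume Γ := by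
  exact ⟨summable_norm_thetaKernelTerm hν, fun z w => thetaKernel_eq_zero_comm hχ,
    kernelZeros_inter_eq hχ hΛ, kernelZeros_eq hχ hΛ, iInter_zerosIn_eq_xiSet hν hχ hΛ,
    finite_xiSet hν hχ hΛ, finiteDimensional_thetaSpace hν hχ hΛ, ncard_xiSet_le hν hχ hΛ,
    finrank_thetaSpace hν hχ hΛ⟩
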